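/- Conventions. For integrable $f$ on $\mathbb{R}^d$ let $\mathcal{F}[f](\omega)=\int e^{-i\langle\omega,x\rangle}f(x)\,dx$. For distinct points $t_1,\dots,t_K\in\mathbb{R}^d$ ($d\ge 1$, $K\ge1$) put $\Delta=\min_{k\ne l}\|t_k-t_l\|_2$ ($\Delta=+\infty$ if $K=1$) and $\Delta_+=\min(\Delta,1)$; for $\epsilon>0$ let $N_k(\epsilon)=\{t:\|t-t_k\|_2\le\epsilon\}$ and $F(\epsilon)=\mathbb{R}^d\setminus\bigcup_{k}N_k(\epsilon)$. Statement. There are universal constants $C_0,\upsilon,\gamma,\widetilde{C}>0$ such that the following holds for all $d,K\ge1$, all distinct $t_1,\dots,t_K\in\mathbb{R}^d$ and all integers $m\ge1$ with $m\ge C_0\sqrt{K}\,d^{3/2}/\Delta_+$. Put $\epsilon=\upsilon/(md)$. For every $k\in\{1,\dots,K\}$ there is a function $Q_{k,m}:\mathbb{R}^d\to\mathbb{R}$ with $Q_{k,m}(t_i)=\delta_{ik}$ for all $i$ and $0\le Q_{k,m}\le1$ on $\mathbb{R}^d$, such that: i) if $\|t-t_k\|_2\le\epsilon$, then $0\le Q_{k,m}(t)\le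 1-\widetilde{C}m^2\|t-t_k\|_2^2$; ii) if $i\ne k$ and $\|t-t_i\|_2\le\epsilon$, then $|Q_{k,m}(t)|\le\widetilde{C}m^2\|t-t_i\|_2^2$; iii) if $t\in F(\epsilon)$, then $0\le Q_{k,m}(t)\le 1-\gamma\upsilon^2/d^3$; iv) let $\varphi$ be a probability density on $\mathbb{R}^d$ that is bounded, continuous, symmetric and of positive definite type, and whose Fourier transform $\sigma=\mathcal{F}[\varphi]$ vanishes nowhere on $[-4m,4m]^d$. Let $\lambda:\mathbb{R}^d\to\mathbb{R}$ be bounded, continuous, symmetric and of positive definite type with an integrable spectral density $\mathcal{F}[\lambda]\ge0$ (that is, $\lambda(x)=\int e^{i\langle x,\omega\rangle}\mathcal{F}[\lambda](\omega)\,d\omega$), and suppose that the essential infimum of $\sigma^2\,\mathcal{F}[\lambda]$ over $[-4m,4m]^d$ is positive. Let $\mathbb{L}$ be the real reproducing kernel Hilbert space with kernel $(x,y)\mapsto\lambda(x-y)$. Then there is $c_{k,m}\in\mathbb{L}$ with $Q_{k,m}=\Phi c_{k,m}:=\varphi\star c_{k,m}$, the convolution integral $\int\varphi(x-y)c_{k,m}(y)\,dy$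 being absolutely convergent for every $x\in\mathbb{R}^d$. -/

import Mathlib

open MeasureTheory

noncomputable section

namespace SuperMix

/-- The Euclidean space `ℝ^d`, with the norm `‖·‖₂`. -/
abbrev Space (d : ℕ) : Type := EuclideanSpace ℝ (Fin d)

/-- `Δ₊ = min(Δ, 1)`, where `Δ = min_{k ≠ l} ‖t_k - t_l‖₂` is the minimal separation of the points.
The infimum over the empty set of pairs (a single point) is `+∞`, and then `Δ₊ = 1`. -/
def sepPlus {d K : ℕ} (t : Fin K → Space d) : ℝ :=
  (min (Set.range t).einfsep 1).toReal

/-- The near region `N_k(ε)` of the `k`-th point. -/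
def nearRegion {d K : ℕ} (t : Fin K → Space d) (k : Fin K) (ε : ℝ) : Set (Space d) :=
  {x | ‖x - t k‖ ≤ ε}

/-- The far region `F(ε)`: the complement of the union of all the near regions. -/
def farRegion {d K : ℕ} (t : Fin K → Space d) (ε : ℝ) : Set (Space d) :=
  (⋃ k, nearRegion t k ε)ᶜ

open scoped ComplexOrder in
/-- A bounded continuous symmetric function of positive definite type. -/
structure IsPosDefKernelFun {d : ℕ} (f : Space d → ℝ) : Prop where
  continuous : Continuous f
  bounded : ∃ B : ℝ, ∀ x, |f x| ≤ B
  symm : ∀ x, f (-x) = f x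
  posDef : ∀ (n : ℕ) (x : Fin n → Space d) (z : Fin n → ℂ),
    0 ≤ ∑ i, ∑ j, (f (x i - x j) : ℂ) * z i * (starRingEnd ℂ) (z j)

/-- A probability density on `ℝ^d` with respect to Lebesgue measure. -/
structure IsProbDensity {d : ℕ} (f : Space d → ℝ) : Prop where
  nonneg : ∀ x, 0 ≤ f x
  integrable : Integrable f
  integral_eq_one : ∫ x, f x = 1

/-- The Fourier transform `F[f](ω) = ∫ e^{-i ⟨ω, x⟩} f(x) dx`. -/
def fourierT {d : ℕ} (f : Space d → ℝ) (ω : Space d) : ℂ :=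
  ∫ x, Complex.exp (-(Complex.I * (inner ℝ ω x : ℝ))) * (f x : ℂ)

/-- The cube `[-η, η]^d`. -/
def cube (d : ℕ) (η : ℝ) : Set (Space d) :=
  {ω | ∀ j, |ω j| ≤ η}

/-- The condition `(H_η)` on a density `φ`: its spectral density `σ = F[φ]` does not vanish on the
cube `[-η, η]^d`. -/
def SpectrumContainsCube {d : ℕ} (φ : Space d → ℝ) (η : ℝ) : Prop :=
  ∀ ω ∈ cube d η, fourierT φ ω ≠ 0

/-- `ρ` is the density `F[lam]` of the spectral measure of `lam`: it is nonnegative and integrable,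
and `lam(x) = ∫ e^{i ⟨x, ω⟩} ρ(ω) dω`. -/
structure IsSpectralDensity {d : ℕ} (lam ρ : Space d → ℝ) : Prop where
  nonneg : ∀ ω, 0 ≤ ρ ω
  integrable : Integrable ρ
  eq_integral : ∀ x, (lam x : ℂ) = ∫ ω, Complex.exp (Complex.I * (inner ℝ x ω : ℝ)) * (ρ ω : ℂ)

/-- The (essential) infimum of `σ² F[lam]` over the cube `[-η, η]^d` is positive, where `σ = F[φ]`
and `ρ` is the spectral density of `lam`. -/
def SpectralInfPos {d : ℕ} (φ ρ : Space d → ℝ) (η : ℝ) : Prop :=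
  ∃ b : ℝ, 0 < b ∧ ∀ᵐ ω : Space d, ω ∈ cube d η → b ≤ ‖fourierT φ ω‖ ^ 2 * ρ ω

/-- The real RKHS `H` of functions on `ℝ^d` has the reproducing kernel `(x, y) ↦ lam (x - y)`. -/
def HasKernel {d : ℕ} (H : Type*) [NormedAddCommGroup H] [InnerProductSpace ℝ H] [CompleteSpace H]
    [RKHS ℝ H (Space d) ℝ] (lam : Space d → ℝ) : Prop :=
  ∀ x y : Space d, RKHS.kernel H x y 1 = lam (x - y)

/-- The convolution operator `Φ f = φ ⋆ f`, that is `(Φ f)(x) = ∫ φ(x - y) f(y) dy`. -/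
def Phi {d : ℕ} (φ f : Space d → ℝ) : Space d → ℝ :=
  convolution φ f (ContinuousLinearMap.mul ℝ ℝ) volume

end SuperMix

end

/-! ### The Fejér kernel: decay, curvature at the origin, positive definiteness. -/

namespace SuperMix

/-! Let f be the tensorized Fejér kernel `fejer (m/2)`, with spectrum in `[-m, m]^d`. It decays like
`1 / (1 + m² ‖x‖² / 16)`, so the separation condition makes the matrix `f (t i - t l)` strictly
diagonally dominant. Hence some combination P of the translates `f (· - t l)` takes the value 1 at
`t k` and 0 at the other points, with coefficients within δ = O(d⁻²) of a basis vector in ℓ¹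
(`exists_fejerSum_interpolation`).

No condition is imposed on the gradient of P; reflection replaces it. Put Q(x) = (P(x) P(2 t_k -
x))². With x = t_k + h, the product is at most the square of (P(t_k + h) + P(t_k - h)) / 2, in which
the odd part of P has disappeared. What remains is a second difference. Since f is the
characteristic function of a probability measure, its second differences are at most 2 (1 - f(h))
everywhere, so the perturbing translates spoil the decrease of f at the origin only by a factor 1 -
δ. Near another point P vanishes, and Krein's inequality bounds P² by a multiple of 1 - f(h), hence
quadratically. Away from `t k`, P differs from `f (· - t k)` by at most δ, and the decay of f
suffices.

Q is a product of four functions of band m, so its spectrum g is bounded and supported in `[-4m,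
4m]^d`. Dividing g by σ gives the spectrum G of a deconvolved function. The lower bound on σ²
`F[lam]` yields |G| ≤ M √`F[lam]` on the cube, so integration against G is a bounded functional on
the span of the kernel functions, and the Riesz theorem provides c (`exists_rkhs_convolution_eq`).
-/

lemma sinc_sq_le (y : ℝ) : Real.sinc y ^ 2 ≤ 1 / (1 + y ^ 2 / 4) := by
  rcases eq_or_ne y 0 with rfl | hy
  · simp
  have hy2 : 0 < y ^ 2 := by positivity
  rw [Real.sinc_of_ne_zero hy, div_pow, div_le_div_iff₀ hy2 (by positivity), one_mul]
  -- For small `y`, the double-angle formula reduces the claim to `cos² z ≤ 1 / (1 + z²)` and `sin²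
  -- z ≤ z²` at `z = y / 2`. For large `y`, `sin² ≤ 1` is enough.
  by_cases h : |y| ≤ 2
  · have hc : Real.cos (y / 2) ^ 2 ≤ 1 / ((y / 2) ^ 2 + 1) := by
      have h3 := Real.pi_gt_three
      have h1 := abs_le.mp h
      have h0 : 0 ≤ Real.cos (y / 2) := Real.cos_nonneg_of_mem_Icc ⟨by linarith, by linarith⟩
      have hle := Real.cos_le_one_div_sqrt_sq_add_one (x := y / 2) (by linarith) (by linarith)
      calc Real.cos (y / 2) ^ 2 ≤ (1 / √((y / 2) ^ 2 + 1)) ^ 2 := by gcongr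
        _ = 1 / ((y / 2) ^ 2 + 1) := by
          rw [div_pow, one_pow, Real.sq_sqrt (by positivity)]
    have hs : Real.sin (y / 2) ^ 2 ≤ (y / 2) ^ 2 := sq_le_sq.mpr Real.abs_sin_le_abs
    have e : Real.sin y = 2 * Real.sin (y / 2) * Real.cos (y / 2) := by
      rw [← Real.sin_two_mul]; ring_nf
    rw [le_div_iff₀ (by positivity)] at hc
    rw [e]
    calc (2 * Real.sin (y / 2) * Real.cos (y / 2)) ^ 2 * (1 + y ^ 2 / 4)
        = 4 * Real.sin (y / 2) ^ 2 * (Real.cos (y / 2) ^ 2 * ((y / 2) ^ 2 + 1)) := by ring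
      _ ≤ 4 * (y / 2) ^ 2 * 1 := by gcongr
      _ = y ^ 2 := by ring
  · have h2 : 2 ^ 2 ≤ y ^ 2 := by
      rw [← sq_abs y]; push Not at h; gcongr
    nlinarith [Real.sin_sq_le_one y]

lemma one_sub_le_sinc_sq (y : ℝ) : 1 - y ^ 2 / 3 ≤ Real.sinc y ^ 2 := by
  have key : ∀ z : ℝ, 0 < z → 1 - z ^ 2 / 6 ≤ Real.sinc z := by
    intro z hz
    rw [Real.sinc_of_ne_zero hz.ne', le_div_iff₀ hz]
    calc (1 - z ^ 2 / 6) * z = z - z ^ 3 / 6 := by ring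
      _ ≤ Real.sin z := Real.sin_ge_sub_cube hz.le
  have key' : 1 - y ^ 2 / 6 ≤ Real.sinc y := by
    rcases lt_trichotomy y 0 with h | rfl | h
    · simpa using key (-y) (by linarith)
    · simp
    · exact key y h
  by_cases h : y ^ 2 ≤ 6
  · calc 1 - y ^ 2 / 3 ≤ (1 - y ^ 2 / 6) ^ 2 := by nlinarith [sq_nonneg (y ^ 2)]
      _ ≤ Real.sinc y ^ 2 := by gcongr; linarith
  · nlinarith [sq_nonneg (Real.sinc y)]

lemma one_sub_sum_le_prod {ι : Type*} (s : Finset ι) (f g : ι → ℝ) (h0 : ∀ i, 0 ≤ f i)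
    (h1 : ∀ i, f i ≤ 1) (h : ∀ i, 1 - g i ≤ f i) : 1 - ∑ i ∈ s, g i ≤ ∏ i ∈ s, f i := by
  classical
  induction s using Finset.induction_on with
  | empty => simp
  | insert i s hi ih =>
    rw [Finset.sum_insert hi, Finset.prod_insert hi]
    have p1 : ∏ i ∈ s, f i ≤ 1 := Finset.prod_le_one (fun i _ => h0 i) (fun i _ => h1 i)
    nlinarith [h0 i, h1 i, h i]

lemma one_add_sum_le_prod {ι : Type*} (s : Finset ι) (g : ι → ℝ) (h0 : ∀ i, 0 ≤ g i) :
    1 + ∑ i ∈ s, g i ≤ ∏ i ∈ s, (1 + g i) := by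
  classical
  induction s using Finset.induction_on with
  | empty => simp
  | insert i s hi ih =>
    rw [Finset.sum_insert hi, Finset.prod_insert hi]
    have p1 : 0 ≤ ∑ i ∈ s, g i := Finset.sum_nonneg fun i _ => h0 i
    nlinarith [h0 i]

variable {d : ℕ}

/-- The product of one-dimensional cardinal sines: up to normalization, the Fourier transform of
the cube of half-side `a`. -/
noncomputable def sincProd (a : ℝ) (x : Space d) : ℝ := ∏ j, Real.sinc (a * x j)

/-- The multivariate Fejér kernel, with spectrum in the cube of half-side `2 * a`. -/
noncomputable def fejer (a : ℝ) (x : Space d) : ℝ := sincProd a x ^ 2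

lemma fejer_nonneg (a : ℝ) (x : Space d) : 0 ≤ fejer a x := sq_nonneg _

@[simp] lemma fejer_zero (a : ℝ) : fejer a (0 : Space d) = 1 := by simp [fejer, sincProd]

@[simp] lemma fejer_neg (a : ℝ) (x : Space d) : fejer a (-x) = fejer a x := by
  simp [fejer, sincProd]

/-- Expanding `∏ (1 + g j) ≥ 1 + ∑ g j` turns the coordinatewise decay of the sinc factors into
Euclidean decay with a constant free of the dimension. -/
lemma fejer_le (a : ℝ) (x : Space d) : fejer a x ≤ 1 / (1 + a ^ 2 * ‖x‖ ^ 2 / 4) := by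
  rw [fejer, sincProd, ← Finset.prod_pow, EuclideanSpace.norm_sq_eq]
  have h0 : ∀ j, 0 ≤ (a * x j) ^ 2 / 4 := fun j => by positivity
  calc ∏ j, Real.sinc (a * x j) ^ 2 ≤ ∏ j, 1 / (1 + (a * x j) ^ 2 / 4) :=
        Finset.prod_le_prod (fun j _ => sq_nonneg _) fun j _ => sinc_sq_le _
    _ = 1 / ∏ j, (1 + (a * x j) ^ 2 / 4) := by simp
    _ ≤ 1 / (1 + ∑ j, (a * x j) ^ 2 / 4) := by
        apply one_div_le_one_div_of_le
        · have := Finset.sum_nonneg fun j (_ : j ∈ Finset.univ) => h0 j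
          linarith
        · exact one_add_sum_le_prod _ _ h0
    _ = _ := by
        simp only [mul_pow, Real.norm_eq_abs, sq_abs, Finset.mul_sum, Finset.sum_div]

lemma fejer_le_one (a : ℝ) (x : Space d) : fejer a x ≤ 1 := by
  refine (fejer_le a x).trans ?_
  rw [div_le_one (by positivity)]
  linarith [show 0 ≤ a ^ 2 * ‖x‖ ^ 2 by positivity]

lemma one_sub_fejer_le (a : ℝ) (x : Space d) : 1 - fejer a x ≤ a ^ 2 * ‖x‖ ^ 2 / 3 := by
  have := one_sub_sum_le_prod Finset.univ (fun j => Real.sinc (a * x j) ^ 2)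
    (fun j => (a * x j) ^ 2 / 3) (fun j => sq_nonneg _)
    (fun j => (sq_le_one_iff_abs_le_one _).mpr (Real.abs_sinc_le_one _))
    (fun j => one_sub_le_sinc_sq _)
  rw [fejer, sincProd, ← Finset.prod_pow, EuclideanSpace.norm_sq_eq]
  simp only [mul_pow, Real.norm_eq_abs, sq_abs, Finset.mul_sum, Finset.sum_div] at this ⊢
  linarith

lemma measurableSet_cube (d : ℕ) (a : ℝ) : MeasurableSet (cube d a) := by
  rw [cube, Set.ofPred_forall]
  exact MeasurableSet.iInter fun j => measurableSet_le (by fun_prop) measurable_const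

lemma restrict_cube (d : ℕ) (a : ℝ) : (volume : Measure (Space d)).restrict (cube d a) =
    (Measure.pi fun _ : Fin d => (volume : Measure ℝ).restrict (Set.Icc (-a) a)).map
      (WithLp.toLp 2) := by
  rw [← Measure.restrict_pi_pi, ← volume_pi]
  have h := PiLp.volume_preserving_toLp (Fin d)
  rw [← h.map_eq, Measure.restrict_map h.measurable (measurableSet_cube d a)]
  congr 2
  ext x
  simp [cube, abs_le, Pi.le_def, forall_and]

lemma charFun_restrict_Icc {a : ℝ} (ha : 0 < a) (x : ℝ) :
    charFun ((volume : Measure ℝ).restrict (Set.Icc (-a) a)) x = 2 * a * Real.sinc (a * x) := by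
  rw [charFun_apply_real, integral_Icc_eq_integral_Ioc,
    ← intervalIntegral.integral_of_le (by linarith)]
  rcases eq_or_ne x 0 with rfl | hx
  · simp; ring
  · have h := intervalIntegral.integral_comp_mul_left (a := -a) (b := a)
      (fun t : ℝ => Complex.exp (t * Complex.I)) hx
    push_cast at h
    rw [h, mul_neg, integral_exp_mul_I_eq_sinc, mul_comm a x, Complex.real_smul]
    have hx' : (x : ℂ) ≠ 0 := by exact_mod_cast hx
    push_cast
    field_simp

lemma charFun_restrict_cube {a : ℝ} (ha : 0 < a) (x : Space d) :
    charFun ((volume : Measure (Space d)).restrict (cube d a)) x = (2 * a) ^ d * sincProd a x := by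
  rw [restrict_cube, charFun_pi]
  simp [charFun_restrict_Icc ha, Finset.prod_mul_distrib, sincProd]

lemma volume_cube_lt_top (d : ℕ) (a : ℝ) : volume (cube d a) < ⊤ := by
  have : cube d a ⊆ Metric.closedBall 0 (∑ _ : Fin d, |a|) := by
    intro x hx
    rw [mem_closedBall_zero_iff]
    have hs := EuclideanSpace.basisFun (Fin d) ℝ |>.sum_repr x
    rw [← hs]
    refine (norm_sum_le _ _).trans (Finset.sum_le_sum fun j _ => ?_)
    simpa [norm_smul] using (hx j).trans (le_abs_self a)
  exact (measure_mono this).trans_lt measure_closedBall_lt_top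

/-- The Fejér kernel is the characteristic function of a probability measure. -/
lemma exists_charFun_eq_fejer {a : ℝ} (ha : 0 < a) (d : ℕ) :
    ∃ μ : Measure (Space d), IsProbabilityMeasure μ ∧ ∀ x, charFun μ x = fejer a x := by
  set ν₀ := (volume : Measure (Space d)).restrict (cube d a)
  have : IsFiniteMeasure ν₀ := ⟨by simpa [ν₀] using volume_cube_lt_top d a⟩
  obtain ⟨c, hc⟩ : ∃ c : NNReal, (c : ℝ) = ((2 * a) ^ d)⁻¹ := ⟨⟨_, by positivity⟩, rfl⟩
  set ν : Measure (Space d) := c • ν₀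
  have hν : ∀ x, charFun ν x = sincProd a x := by
    intro x
    have : (2 * (a : ℂ)) ^ d ≠ 0 := pow_ne_zero _ (by simp [ha.ne'])
    rw [charFun_apply, integral_smul_nnreal_measure, ← charFun_apply, charFun_restrict_cube ha,
      NNReal.smul_def, Complex.real_smul]
    rw [hc]
    push_cast
    field_simp
  -- The measure is the law of the sum of two independent uniform points of the cube; its total mass
  -- is read off from the characteristic function at 0.
  have hchar : ∀ x, charFun (ν.conv ν) x = fejer a x := by
    intro x
    rw [charFun_conv, hν, fejer]; push_cast; ring
  refine ⟨ν.conv ν, ⟨?_⟩, hchar⟩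
  have h0 := hchar 0
  rw [charFun_zero, fejer_zero] at h0
  have : (ν.conv ν).real Set.univ = 1 := by exact_mod_cast h0
  simpa [measureReal_def, ENNReal.toReal_eq_one_iff] using this

end SuperMix

/-! ### Increments and second differences of real positive definite functions. -/

namespace SuperMix

section PosDef
variable {E : Type*} [NormedAddCommGroup E] [InnerProductSpace ℝ E] [MeasurableSpace E]
  [OpensMeasurableSpace E] [SecondCountableTopology E] (μ : Measure E) [IsProbabilityMeasure μ]

lemma integrable_cos_inner (x : E) : Integrable (fun w => Real.cos (inner ℝ w x)) μ :=
  .of_bound (by fun_prop) 1 (by filter_upwards with w; exact Real.abs_cos_le_one _)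

lemma re_charFun (x : E) : (charFun μ x).re = ∫ w, Real.cos (inner ℝ w x) ∂μ := by
  have hi : Integrable (fun w : E => Complex.exp ((inner ℝ w x : ℝ) * Complex.I)) μ :=
    .of_bound (by fun_prop) 1 (by filter_upwards with w; simp [Complex.norm_exp_ofReal_mul_I])
  rw [charFun_apply, ← RCLike.re_eq_complex_re, ← integral_re hi]
  simp [Complex.exp_ofReal_mul_I_re]

/-- Second differences of a real positive definite function are controlled at the origin. -/
lemma abs_second_diff_re_charFun_le (x h : E) :
    |(charFun μ (x + h)).re + (charFun μ (x - h)).re - 2 * (charFun μ x).re|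
      ≤ 2 * (1 - (charFun μ h).re) := by
  simp only [re_charFun]
  have i1 := integrable_cos_inner μ (x + h)
  have i2 := integrable_cos_inner μ (x - h)
  have i3 := integrable_cos_inner μ x
  have i4 := integrable_cos_inner μ h
  have e1 : (∫ w, Real.cos (inner ℝ w (x + h)) ∂μ) + (∫ w, Real.cos (inner ℝ w (x - h)) ∂μ)
      - 2 * ∫ w, Real.cos (inner ℝ w x) ∂μ
      = ∫ w, (Real.cos (inner ℝ w (x + h)) + Real.cos (inner ℝ w (x - h))
        - 2 * Real.cos (inner ℝ w x)) ∂μ := by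
    rw [← integral_const_mul, ← integral_add i1 i2]
    exact (integral_sub (i1.add i2) (i3.const_mul 2)).symm
  have e2 : 2 * (1 - ∫ w, Real.cos (inner ℝ w h) ∂μ)
      = ∫ w, 2 * (1 - Real.cos (inner ℝ w h)) ∂μ := by
    rw [integral_const_mul, integral_sub (integrable_const _) i4]; simp
  rw [e1, e2, ← Real.norm_eq_abs]
  refine norm_integral_le_of_norm_le (((integrable_const _).sub i4).const_mul 2) ?_
  filter_upwards with w
  rw [inner_add_right, inner_sub_right, Real.cos_add, Real.cos_sub, Real.norm_eq_abs]
  rw [show ∀ a b c e : ℝ, a * b - c * e + (a * b + c * e) - 2 * a = a * -(2 * (1 - b)) by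
    intros; ring, abs_mul, abs_neg]
  have hc := Real.cos_le_one (inner ℝ w h)
  rw [abs_of_nonneg (a := 2 * (1 - Real.cos (inner ℝ w h))) (by linarith)]
  exact mul_le_of_le_one_left (by linarith) (Real.abs_cos_le_one _)

/-- Krein's inequality for the increments of a real positive definite function. -/
lemma sq_sub_re_charFun_le (x h : E) :
    ((charFun μ (x + h)).re - (charFun μ x).re) ^ 2 ≤ 2 * (1 - (charFun μ h).re) := by
  simp only [re_charFun]
  have i1 := integrable_cos_inner μ (x + h)
  have i3 := integrable_cos_inner μ x
  have i4 := integrable_cos_inner μ h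
  set f : E → ℝ := fun w => Real.cos (inner ℝ w (x + h)) - Real.cos (inner ℝ w x) with hf
  set D := ∫ w, f w ∂μ with hD
  have e1 : (∫ w, Real.cos (inner ℝ w (x + h)) ∂μ) - ∫ w, Real.cos (inner ℝ w x) ∂μ = D := by
    rw [hD, hf, integral_sub i1 i3]
  have e2 : 2 * (1 - ∫ w, Real.cos (inner ℝ w h) ∂μ)
      = ∫ w, 2 * (1 - Real.cos (inner ℝ w h)) ∂μ := by
    rw [integral_const_mul, integral_sub (integrable_const _) i4]; simp
  have hfi : Integrable f μ := i1.sub i3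
  -- Jensen's inequality by its tangent line: `2 D f - D² ≤ f²` pointwise, with `D` the mean of `f`.
  have e3 : D ^ 2 = ∫ w, (2 * D * f w - D ^ 2) ∂μ := by
    rw [integral_sub (hfi.const_mul _) (integrable_const _), integral_const_mul, ← hD]
    simp; ring
  rw [e1, e2, e3]
  refine integral_mono ((hfi.const_mul _).sub (integrable_const _))
    (((integrable_const _).sub i4).const_mul 2) fun w => ?_
  have hb : f w ^ 2 ≤ 2 * (1 - Real.cos (inner ℝ w h)) := by
    simp only [hf, inner_add_right, Real.cos_add]
    set s := Real.sin (inner ℝ w x)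
    set c := Real.cos (inner ℝ w x)
    set S := Real.sin (inner ℝ w h)
    set C := Real.cos (inner ℝ w h)
    have h1 : s ^ 2 + c ^ 2 = 1 := Real.sin_sq_add_cos_sq _
    have h2 : S ^ 2 + C ^ 2 = 1 := Real.sin_sq_add_cos_sq _
    -- This is `|e^{iθ}(e^{iψ} - 1)|² = 2 - 2 cos ψ`, split into real and imaginary parts; `f w` is
    -- the real part.
    have key : (c * C - s * S - c) ^ 2 + (s * (C - 1) + c * S) ^ 2
        = (s ^ 2 + c ^ 2) * ((S ^ 2 + C ^ 2) + 1 - 2 * C) := by ring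
    rw [h1, h2] at key
    nlinarith [sq_nonneg (s * (C - 1) + c * S)]
  nlinarith [sq_nonneg (f w - D)]

end PosDef

variable {d : ℕ} {a : ℝ}

lemma abs_second_diff_fejer_le (ha : 0 < a) (x h : Space d) :
    |fejer a (x + h) + fejer a (x - h) - 2 * fejer a x| ≤ 2 * (1 - fejer a h) := by
  obtain ⟨μ, hμ, e⟩ := exists_charFun_eq_fejer ha d
  simpa [e] using abs_second_diff_re_charFun_le μ x h

lemma sq_sub_fejer_le (ha : 0 < a) (x h : Space d) :
    (fejer a (x + h) - fejer a x) ^ 2 ≤ 2 * (1 - fejer a h) := by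
  obtain ⟨μ, hμ, e⟩ := exists_charFun_eq_fejer ha d
  simpa [e] using sq_sub_re_charFun_le μ x h

end SuperMix

/-! ### Interpolation by translates of the kernel. -/

namespace SuperMix

/-- A matrix with unit diagonal and small off-diagonal entries is invertible, and the columns of
the inverse are close to the standard basis in `ℓ¹` norm. -/
lemma exists_solution_of_near_one {ι : Type*} [Fintype ι] [DecidableEq ι] (A : ι → ι → ℝ)
    (k : ι) {τ : ℝ} (hτ : 0 ≤ τ) (hdiag : ∀ i, A i i = 1) (hoff : ∀ i j, i ≠ j → |A i j| ≤ τ)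
    (hsmall : Fintype.card ι * τ ≤ 1 / 2) :
    ∃ α : ι → ℝ, (∀ i, ∑ l, α l * A i l = if i = k then 1 else 0) ∧
      ∑ l, |α l - if l = k then 1 else 0| ≤ 2 * (Fintype.card ι * τ) := by
  have hdet : (Matrix.of A).det ≠ 0 := by
    apply det_ne_zero_of_sum_row_lt_diag
    intro i
    simp only [Matrix.of_apply, hdiag, norm_one, Real.norm_eq_abs]
    calc ∑ j ∈ Finset.univ.erase i, |A i j| ≤ ∑ j ∈ Finset.univ.erase i, τ :=
          Finset.sum_le_sum fun j hj => hoff i j (Finset.ne_of_mem_erase hj).symm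
      _ ≤ ∑ j : ι, τ := Finset.sum_le_sum_of_subset_of_nonneg (Finset.erase_subset _ _)
          fun _ _ _ => hτ
      _ = Fintype.card ι * τ := by simp
      _ < 1 := by linarith
  set e : ι → ℝ := fun i => if i = k then 1 else 0 with he
  set α : ι → ℝ := (Matrix.of A)⁻¹.mulVec e with hα
  have hsol : ∀ i, ∑ l, α l * A i l = e i := by
    intro i
    have : (Matrix.of A).mulVec α = e := by
      rw [hα, Matrix.mulVec_mulVec, Matrix.mul_nonsing_inv _ (isUnit_iff_ne_zero.mpr hdet),
        Matrix.one_mulVec]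
    rw [← this]
    simp [Matrix.mulVec, dotProduct, mul_comm]
  refine ⟨α, hsol, ?_⟩
  set S := ∑ l, |α l| with hS
  have hrow : ∀ i, |α i - e i| ≤ τ * S := by
    intro i
    have h1 : α i - e i = -∑ l ∈ Finset.univ.erase i, α l * A i l := by
      rw [← hsol i, ← Finset.add_sum_erase _ _ (Finset.mem_univ i), hdiag]; ring
    rw [h1, abs_neg]
    calc |∑ l ∈ Finset.univ.erase i, α l * A i l|
        ≤ ∑ l ∈ Finset.univ.erase i, |α l * A i l| := Finset.abs_sum_le_sum_abs _ _
      _ ≤ ∑ l ∈ Finset.univ.erase i, |α l| * τ := Finset.sum_le_sum fun l hl => by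
          rw [abs_mul]
          exact mul_le_mul_of_nonneg_left (hoff i l (Finset.ne_of_mem_erase hl).symm)
            (abs_nonneg _)
      _ ≤ ∑ l, |α l| * τ := Finset.sum_le_sum_of_subset_of_nonneg (Finset.erase_subset _ _)
          fun _ _ _ => by positivity
      _ = τ * S := by rw [← Finset.sum_mul, mul_comm]
  have hsum : ∑ l, |α l - e l| ≤ Fintype.card ι * τ * S :=
    (Finset.sum_le_sum fun l _ => hrow l).trans (by simp [mul_assoc])
  have hS1 : S ≤ ∑ l, |α l - e l| + 1 := by
    have h2 : ∑ l, |e l| = 1 := by simp [he, apply_ite abs]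
    rw [← h2, ← Finset.sum_add_distrib]
    refine Finset.sum_le_sum fun l _ => ?_
    calc |α l| = |(α l - e l) + e l| := by ring_nf
      _ ≤ _ := abs_add_le _ _
  have hS0 : 0 ≤ S := Finset.sum_nonneg fun l _ => abs_nonneg _
  -- The self-bound `S ≤ 1 + card ι * τ * S ≤ 1 + S / 2` closes up.
  have hS2 : S ≤ 2 := by nlinarith
  have hc : 0 ≤ Fintype.card ι * τ := by positivity
  calc ∑ l, |α l - e l| ≤ Fintype.card ι * τ * S := hsum
    _ ≤ _ := by nlinarith

section Separation
variable {d K : ℕ} {t : Fin K → Space d}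

lemma sepPlus_pos (t : Fin K → Space d) : 0 < sepPlus t := by
  rw [sepPlus, ENNReal.toReal_pos_iff]
  exact ⟨lt_min (Set.finite_range t).einfsep_pos one_pos,
    (min_le_right _ _).trans_lt ENNReal.one_lt_top⟩

lemma sepPlus_le_norm_sub (ht : Function.Injective t) {i j : Fin K} (hij : i ≠ j) :
    sepPlus t ≤ ‖t i - t j‖ := by
  have h := Set.einfsep_le_edist_of_mem (Set.mem_range_self (f := t) i)
    (Set.mem_range_self (f := t) j) (ht.ne hij)
  rw [← dist_eq_norm, sepPlus, dist_edist]
  exact ENNReal.toReal_mono (edist_ne_top _ _) ((min_le_left _ _).trans h)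

end Separation

/-- A combination of translates of the Fejér kernel. -/
noncomputable def fejerSum {d K : ℕ} (a : ℝ) (t : Fin K → Space d) (α : Fin K → ℝ) (x : Space d) :
    ℝ := ∑ l, α l * fejer a (x - t l)

lemma exists_fejerSum_interpolation {d K m : ℕ} {t : Fin K → Space d} (hd : 1 ≤ d) (hm : 1 ≤ m)
    (ht : Function.Injective t)
    (h : 1000 * √(K : ℝ) * (d : ℝ) ^ (3 / 2 : ℝ) / sepPlus t ≤ (m : ℝ)) (k : Fin K) :
    ∃ α : Fin K → ℝ, (∀ i, fejerSum (m / 2) t α (t i) = if i = k then 1 else 0) ∧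
      ∑ l, |α l - if l = k then 1 else 0| ≤ 1 / (10000 * (d : ℝ) ^ 2) := by
  have hd' : (1 : ℝ) ≤ d := by exact_mod_cast hd
  have hK : (0 : ℝ) < K := by exact_mod_cast k.pos
  have hm' : (1 : ℝ) ≤ m := by exact_mod_cast hm
  have hs := sepPlus_pos t
  rw [div_le_iff₀ hs] at h
  have hsq : 1000000 * K * (d : ℝ) ^ 3 ≤ (m * sepPlus t) ^ 2 := by
    have h1 : (1000 * √(K : ℝ) * (d : ℝ) ^ (3 / 2 : ℝ)) ^ 2 = 1000000 * K * (d : ℝ) ^ 3 := by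
      rw [mul_pow, mul_pow, Real.sq_sqrt hK.le, ← Real.rpow_natCast ((d : ℝ) ^ (3 / 2 : ℝ)),
        ← Real.rpow_mul (by positivity)]
      norm_num
    rw [← h1]
    gcongr
  -- The decay gives entries at most `16 / (m Δ₊)²`. The factor `√K` in the separation condition
  -- cancels the `K` entries of a row, and `d^{3/2}` leaves `d⁻³`, more than the `d⁻²` required.
  set τ : ℝ := 16 / (1000000 * K * (d : ℝ) ^ 3) with hτ
  have hKτ : K * τ = 16 / (1000000 * (d : ℝ) ^ 3) := by rw [hτ]; field_simp
  have hd23 : (d : ℝ) ^ 2 ≤ (d : ℝ) ^ 3 := pow_le_pow_right₀ hd' (by norm_num)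
  have hd2 : 1 ≤ (d : ℝ) ^ 2 := one_le_pow₀ hd'
  have hoff : ∀ i j, i ≠ j → |fejer ((m : ℝ) / 2) (t i - t j)| ≤ τ := by
    intro i j hij
    rw [abs_of_nonneg (fejer_nonneg _ _)]
    refine (fejer_le _ _).trans ?_
    have hle := sepPlus_le_norm_sub ht hij
    have : (m * sepPlus t) ^ 2 ≤ (m * ‖t i - t j‖) ^ 2 := by gcongr
    rw [hτ, div_le_div_iff₀ (by positivity) (by positivity)]
    nlinarith
  have hsmall : Fintype.card (Fin K) * τ ≤ 1 / 2 := by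
    rw [Fintype.card_fin, hKτ, div_le_div_iff₀ (by positivity) (by norm_num)]
    nlinarith
  obtain ⟨α, h1, h2⟩ := exists_solution_of_near_one
    (fun i l => fejer ((m : ℝ) / 2) (t i - t l)) k (τ := τ) (by positivity) (by simp) hoff hsmall
  refine ⟨α, h1, h2.trans ?_⟩
  rw [Fintype.card_fin, hKτ, mul_div_assoc', div_le_div_iff₀ (by positivity) (by positivity)]
  nlinarith

section Bounds
variable {d K : ℕ} {a δ : ℝ} {t : Fin K → Space d} {α : Fin K → ℝ} {k : Fin K}

lemma fejerSum_eq (a : ℝ) (t : Fin K → Space d) (α : Fin K → ℝ) (k : Fin K) (x : Space d) :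
    fejerSum a t α x = fejer a (x - t k)
      + ∑ l, (α l - if l = k then 1 else 0) * fejer a (x - t l) := by
  simp [fejerSum, sub_mul, Finset.sum_sub_distrib]

lemma abs_sum_mul_le {ι : Type*} [Fintype ι] (β f : ι → ℝ) {B : ℝ} (hf : ∀ l, |f l| ≤ B) :
    |∑ l, β l * f l| ≤ (∑ l, |β l|) * B := by
  rw [Finset.sum_mul]
  refine (Finset.abs_sum_le_sum_abs _ _).trans (Finset.sum_le_sum fun l _ => ?_)
  rw [abs_mul]
  exact mul_le_mul_of_nonneg_left (hf l) (abs_nonneg _)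

lemma abs_fejerSum_sub_le (hα : ∑ l, |α l - if l = k then 1 else 0| ≤ δ) (x : Space d) :
    |fejerSum a t α x - fejer a (x - t k)| ≤ δ := by
  rw [fejerSum_eq a t α k, add_sub_cancel_left]
  refine (abs_sum_mul_le _ _ (B := 1) fun l => ?_).trans (by simpa using hα)
  rw [abs_of_nonneg (fejer_nonneg _ _)]
  exact fejer_le_one _ _

/-- The main translate contributes exactly `-2 (1 - fejer a h)` to the second difference at `t k`,
and the remaining coefficients, of total mass `δ`, at most `2 δ (1 - fejer a h)`. -/
lemma fejerSum_symm_le (ha : 0 < a) (hα : ∑ l, |α l - if l = k then 1 else 0| ≤ δ)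
    (h1 : fejerSum a t α (t k) = 1) (h : Space d) :
    (fejerSum a t α (t k + h) + fejerSum a t α (t k - h)) / 2
      ≤ 1 - (1 - δ) * (1 - fejer a h) := by
  have hsd := abs_sum_mul_le (fun l => α l - if l = k then 1 else 0)
    (fun l => fejer a (t k - t l + h) + fejer a (t k - t l - h) - 2 * fejer a (t k - t l))
    fun l => abs_second_diff_fejer_le ha (t k - t l) h
  have hu : 0 ≤ 1 - fejer a h := sub_nonneg.mpr (fejer_le_one _ _)
  have hsum : ∑ l, (α l - if l = k then 1 else 0) *
      (fejer a (t k - t l + h) + fejer a (t k - t l - h) - 2 * fejer a (t k - t l))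
      = (fejerSum a t α (t k + h) + fejerSum a t α (t k - h) - 2)
        + 2 * (1 - fejer a h) := by
    rw [fejerSum_eq a t α k (t k + h), fejerSum_eq a t α k (t k - h)]
    have e := fejerSum_eq a t α k (t k)
    rw [h1] at e
    simp only [mul_sub, mul_add, Finset.sum_add_distrib, Finset.sum_sub_distrib,
      mul_left_comm _ (2 : ℝ), ← Finset.mul_sum, add_sub_right_comm, sub_self, zero_add,
      fejer_zero, sub_right_comm (t k) h, zero_sub, fejer_neg] at e ⊢
    linarith
  rw [hsum] at hsd
  have := (abs_le.mp (hsd.trans (mul_le_mul_of_nonneg_right hα (by linarith)))).2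
  linarith

lemma sq_sub_fejerSum_le (ha : 0 < a) (hα : ∑ l, |α l - if l = k then 1 else 0| ≤ δ)
    (x h : Space d) :
    (fejerSum a t α (x + h) - fejerSum a t α x) ^ 2 ≤ (1 + δ) ^ 2 * (2 * (1 - fejer a h)) := by
  have hu : 0 ≤ 2 * (1 - fejer a h) := by linarith [fejer_le_one a h]
  have hS : ∑ l, |α l| ≤ 1 + δ := by
    have h2 : ∑ l, |(if l = k then 1 else 0 : ℝ)| = 1 := by simp [apply_ite abs]
    calc ∑ l, |α l| ≤ ∑ l, (|(if l = k then 1 else 0 : ℝ)| + |α l - if l = k then 1 else 0|) :=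
          Finset.sum_le_sum fun l _ => by
            calc |α l| = |(if l = k then 1 else 0 : ℝ) + (α l - if l = k then 1 else 0)| := by
                  ring_nf
              _ ≤ _ := abs_add_le _ _
      _ ≤ 1 + δ := by rw [Finset.sum_add_distrib, h2]; linarith
  have hd : |fejerSum a t α (x + h) - fejerSum a t α x| ≤ (1 + δ) * √(2 * (1 - fejer a h)) := by
    have e : fejerSum a t α (x + h) - fejerSum a t α x
        = ∑ l, α l * (fejer a (x - t l + h) - fejer a (x - t l)) := by
      simp [fejerSum, mul_sub, Finset.sum_sub_distrib, add_sub_right_comm]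
    rw [e]
    refine (abs_sum_mul_le _ _ (B := √(2 * (1 - fejer a h))) fun l =>
      Real.abs_le_sqrt (sq_sub_fejer_le ha _ _)).trans ?_
    gcongr
  calc _ = |fejerSum a t α (x + h) - fejerSum a t α x| ^ 2 := (sq_abs _).symm
    _ ≤ ((1 + δ) * √(2 * (1 - fejer a h))) ^ 2 := by gcongr
    _ = _ := by rw [mul_pow, Real.sq_sqrt hu]

end Bounds

end SuperMix

/-! ### The certificate and its bounds in the near and far regions. -/

namespace SuperMix

/-- The certificate attached to `t k`: the square of the product of the interpolant `fejerSum` and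
of its reflection through `t k`. -/
noncomputable def certificate {d K : ℕ} (a : ℝ) (t : Fin K → Space d) (α : Fin K → ℝ) (k : Fin K)
    (x : Space d) : ℝ := (fejerSum a t α x * fejerSum a t α (t k - (x - t k))) ^ 2

section Certificate
variable {d K m : ℕ} {t : Fin K → Space d} {α : Fin K → ℝ} {k : Fin K}

lemma certificate_apply {a : ℝ} (h1 : ∀ i, fejerSum a t α (t i) = if i = k then 1 else 0)
    (i : Fin K) : certificate a t α k (t i) = if i = k then 1 else 0 := by
  rcases eq_or_ne i k with rfl | h
  · simp [certificate, h1]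
  · simp [certificate, h1, h]

lemma certificate_nonneg (a : ℝ) (t : Fin K → Space d) (α : Fin K → ℝ) (k : Fin K)
    (x : Space d) : 0 ≤ certificate a t α k x := sq_nonneg _

lemma abs_fejerSum_le {a δ : ℝ} (hα : ∑ l, |α l - if l = k then 1 else 0| ≤ δ) (x : Space d) :
    |fejerSum a t α x| ≤ fejer a (x - t k) + δ := by
  have h1 := abs_le.mp (abs_fejerSum_sub_le (a := a) (t := t) hα x)
  have h2 := fejer_nonneg a (x - t k)
  rw [abs_le]
  constructor <;> linarith

lemma scaled_norm_le (hd : 1 ≤ d) (hm : 1 ≤ m) {h : Space d}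
    (hh : ‖h‖ ≤ (1 / 10 : ℝ) / (m * d)) : ((m : ℝ) / 2) ^ 2 * ‖h‖ ^ 2 ≤ 1 / 400 := by
  have hd' : (1 : ℝ) ≤ d := by exact_mod_cast hd
  have hm' : (1 : ℝ) ≤ m := by exact_mod_cast hm
  have h1 : m * ‖h‖ ≤ 1 / 10 := by
    calc m * ‖h‖ ≤ m * ((1 / 10 : ℝ) / (m * d)) := by gcongr
      _ = (1 / 10) / d := by field_simp
      _ ≤ 1 / 10 := div_le_self (by norm_num) hd'
  have h2 : (m * ‖h‖) ^ 2 ≤ (1 / 10) ^ 2 := by gcongr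
  nlinarith

lemma delta_le (hd : 1 ≤ d) : 1 / (10000 * (d : ℝ) ^ 2) ≤ 1 / 10000 := by
  have hd2 : 1 ≤ (d : ℝ) ^ 2 := one_le_pow₀ (by exact_mod_cast hd)
  exact one_div_le_one_div_of_le (by norm_num) (by linarith)

lemma le_one_sub_fejer {a : ℝ} {h : Space d} (hh : a ^ 2 * ‖h‖ ^ 2 ≤ 1 / 400) :
    249 / 1000 * (a ^ 2 * ‖h‖ ^ 2) ≤ 1 - fejer a h := by
  have hle := fejer_le a h
  set Y := a ^ 2 * ‖h‖ ^ 2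
  have hY : 0 ≤ Y := by positivity
  have : 1 / (1 + Y / 4) ≤ 1 - 249 / 1000 * Y := by
    rw [div_le_iff₀ (by positivity)]; nlinarith
  linarith

lemma certificate_le_near_self (hd : 1 ≤ d) (hm : 1 ≤ m)
    (h1 : ∀ i, fejerSum (m / 2) t α (t i) = if i = k then 1 else 0)
    (h2 : ∑ l, |α l - if l = k then 1 else 0| ≤ 1 / (10000 * (d : ℝ) ^ 2)) {x : Space d}
    (hx : ‖x - t k‖ ≤ (1 / 10 : ℝ) / (m * d)) :
    certificate (m / 2) t α k x ≤ 1 - 1 / 5 * (m : ℝ) ^ 2 * ‖x - t k‖ ^ 2 := by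
  have hα := h2.trans (delta_le hd)
  have ha : (0 : ℝ) < m / 2 := by positivity
  obtain ⟨h, rfl⟩ : ∃ h, x = t k + h := ⟨x - t k, by abel⟩
  rw [add_sub_cancel_left] at hx
  have hY := scaled_norm_le hd hm hx
  have hl := le_one_sub_fejer hY
  have hr := one_sub_fejer_le ((m : ℝ) / 2) h
  have hA := fejerSum_symm_le ha hα ((h1 k).trans (if_pos rfl)) h
  have hp := abs_le.mp (abs_fejerSum_sub_le (a := (m : ℝ) / 2) (t := t) hα (t k + h))
  have hn := abs_le.mp (abs_fejerSum_sub_le (a := (m : ℝ) / 2) (t := t) hα (t k - h))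
  rw [add_sub_cancel_left] at hp
  rw [sub_sub_cancel_left, fejer_neg] at hn
  rw [certificate, add_sub_cancel_left,
    show 1 / 5 * (m : ℝ) ^ 2 * ‖h‖ ^ 2 = 4 / 5 * (((m : ℝ) / 2) ^ 2 * ‖h‖ ^ 2) by ring]
  set Y := ((m : ℝ) / 2) ^ 2 * ‖h‖ ^ 2
  set p := fejerSum ((m : ℝ) / 2) t α (t k + h)
  set n := fejerSum ((m : ℝ) / 2) t α (t k - h)
  set u := 1 - fejer ((m : ℝ) / 2) h with hu
  have hY0 : 0 ≤ Y := by positivity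
  have hp0 : 0 ≤ p := by linarith
  have hn0 : 0 ≤ n := by linarith
  set v := (1 - 1 / 10000) * u with hv
  have hv1 : 248 / 1000 * Y ≤ v := by linarith
  have hv2 : v ≤ 1 / 1000 := by linarith
  -- By AM-GM only the symmetric part of the interpolant matters. The fourth power then gives a
  -- decrease of about `4 v ≈ Y = m² ‖h‖² / 4`, which leaves room for the constant `1/5`.
  calc (p * n) ^ 2 ≤ (((p + n) / 2) ^ 2) ^ 2 := by
        gcongr; nlinarith [sq_nonneg (p - n)]
    _ = ((p + n) / 2) ^ 4 := by ring
    _ ≤ (1 - v) ^ 4 := by gcongr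
    _ ≤ 1 - 4 / 5 * Y := by
        have hv0 : 0 ≤ v := by linarith
        have hw : (1 - v) ^ 2 ≤ 1 - 1.99 * v := by nlinarith
        calc (1 - v) ^ 4 = ((1 - v) ^ 2) ^ 2 := by ring
          _ ≤ (1 - 1.99 * v) ^ 2 := by gcongr
          _ ≤ _ := by nlinarith

lemma certificate_le_near_other (hd : 1 ≤ d) (hm : 1 ≤ m)
    (h1 : ∀ i, fejerSum (m / 2) t α (t i) = if i = k then 1 else 0)
    (h2 : ∑ l, |α l - if l = k then 1 else 0| ≤ 1 / (10000 * (d : ℝ) ^ 2)) {i : Fin K}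
    (hi : i ≠ k) (x : Space d) :
    certificate (m / 2) t α k x ≤ 1 / 5 * (m : ℝ) ^ 2 * ‖x - t i‖ ^ 2 := by
  have hα := h2.trans (delta_le hd)
  have ha : (0 : ℝ) < m / 2 := by positivity
  obtain ⟨h, rfl⟩ : ∃ h, x = t i + h := ⟨x - t i, by abel⟩
  have hs := sq_sub_fejerSum_le (t := t) ha hα (t i) h
  rw [h1, if_neg hi, sub_zero] at hs
  have hr := one_sub_fejer_le ((m : ℝ) / 2) h
  have hb := abs_fejerSum_le (a := (m : ℝ) / 2) (t := t) hα (t k - (t i + h - t k))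
  have hb' : |fejerSum ((m : ℝ) / 2) t α (t k - (t i + h - t k))| ≤ 1 + 1 / 10000 := by
    linarith [fejer_le_one ((m : ℝ) / 2) (t k - (t i + h - t k) - t k)]
  rw [certificate, mul_pow, add_sub_cancel_left]
  -- The leading constant is `2 · (1/4) · (1/3) = 1/6`. One constant must serve both kinds of near
  -- region, so it is taken between `1/6` and `1/4`.
  calc _ ≤ ((1 + 1 / 10000) ^ 2 * (2 * (((m : ℝ) / 2) ^ 2 * ‖h‖ ^ 2 / 3))) *
        (1 + 1 / 10000) ^ 2 := by
        gcongr ?_ * ?_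
        · exact hs.trans (by gcongr)
        · rw [← sq_abs]; gcongr
    _ ≤ _ := by
        have : 0 ≤ (m : ℝ) ^ 2 * ‖h‖ ^ 2 := by positivity
        nlinarith

lemma certificate_le_far (hd : 1 ≤ d) (hm : 1 ≤ m)
    (h2 : ∑ l, |α l - if l = k then 1 else 0| ≤ 1 / (10000 * (d : ℝ) ^ 2)) {x : Space d}
    (hx : (1 / 10 : ℝ) / (m * d) ≤ ‖x - t k‖) :
    certificate (m / 2) t α k x ≤ 1 - 1 / 20 * ((1 / 10 : ℝ) ^ 2 / (d : ℝ) ^ 3) := by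
  have hd' : (1 : ℝ) ≤ d := by exact_mod_cast hd
  have hm' : (1 : ℝ) ≤ m := by exact_mod_cast hm
  have hd2 : 1 ≤ (d : ℝ) ^ 2 := one_le_pow₀ hd'
  -- The kernel loses about `1 / (1600 d²)` at this distance, against the perturbation `1 / (10000
  -- d²)`; a net loss of `1 / (2000 d²)` survives.
  have key : ∀ h : Space d, (1 / 10 : ℝ) / (m * d) ≤ ‖h‖ →
      fejer ((m : ℝ) / 2) h + 1 / (10000 * (d : ℝ) ^ 2) ≤ 1 - 1 / (2000 * (d : ℝ) ^ 2) := by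
    intro h hh
    have hY : 1 / (1600 * (d : ℝ) ^ 2) ≤ ((m : ℝ) / 2) ^ 2 * ‖h‖ ^ 2 / 4 := by
      calc 1 / (1600 * (d : ℝ) ^ 2) = ((m : ℝ) / 2) ^ 2 * ((1 / 10 : ℝ) / (m * d)) ^ 2 / 4 := by
            field_simp; norm_num
        _ ≤ _ := by gcongr
    have hf : fejer ((m : ℝ) / 2) h ≤ 1 / (1 + 1 / (1600 * (d : ℝ) ^ 2)) :=
      (fejer_le _ _).trans (by gcongr)
    set z := 1 / (d : ℝ) ^ 2 with hz
    have hz0 : 0 ≤ z := by positivity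
    have hz1 : z ≤ 1 := by rw [hz, div_le_one (by positivity)]; exact hd2
    have e : ∀ c : ℝ, 1 / (c * (d : ℝ) ^ 2) = 1 / c * z := fun c => by
      rw [hz, one_div_mul_one_div]
    rw [e] at hf ⊢
    rw [e]
    have : 1 / (1 + 1 / 1600 * z) ≤ 1 - 1 / 1601 * z := by
      rw [div_le_iff₀ (by positivity)]; nlinarith
    linarith
  have hb : ∀ y : Space d, (1 / 10 : ℝ) / (m * d) ≤ ‖y - t k‖ →
      |fejerSum ((m : ℝ) / 2) t α y| ≤ 1 - 1 / (2000 * (d : ℝ) ^ 2) := fun y hy =>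
    (abs_fejerSum_le h2 y).trans (key _ hy)
  have hp := hb x hx
  have hn := hb (t k - (x - t k)) (by rwa [sub_sub_cancel_left, norm_neg])
  set w := 1 - 1 / (2000 * (d : ℝ) ^ 2) with hw
  have hw0 : 0 ≤ w := (abs_nonneg _).trans hp
  have hw1 : w ≤ 1 := by rw [hw]; linarith [show 0 ≤ 1 / (2000 * (d : ℝ) ^ 2) by positivity]
  calc certificate (m / 2) t α k x
      = (|fejerSum ((m : ℝ) / 2) t α x| * |fejerSum ((m : ℝ) / 2) t α (t k - (x - t k))|) ^ 2 := by
        rw [certificate, ← abs_mul, sq_abs]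
    _ ≤ (w * 1) ^ 2 := by gcongr; exact hn.trans hw1
    _ ≤ w := by nlinarith
    _ ≤ _ := by
        have h3 : (d : ℝ) ^ 2 ≤ (d : ℝ) ^ 3 := pow_le_pow_right₀ hd' (by norm_num)
        have : 1 / (2000 * (d : ℝ) ^ 3) ≤ 1 / (2000 * (d : ℝ) ^ 2) := by gcongr
        have e : 1 / 20 * ((1 / 10 : ℝ) ^ 2 / (d : ℝ) ^ 3) = 1 / (2000 * (d : ℝ) ^ 3) := by
          field_simp; norm_num
        rw [e, hw]; linarith

end Certificate

end SuperMix

/-! ### Band-limited functions and the spectrum of the certificate. -/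

namespace SuperMix

variable {d : ℕ}

/-- The inverse Fourier integral of `g`, with kernel `e^{i ⟨x, ω⟩}`. -/
noncomputable def invFourierT (g : Space d → ℂ) (x : Space d) : ℂ :=
  ∫ ω, Complex.exp (Complex.I * (inner ℝ x ω : ℝ)) * g ω

/-- `g` is a bounded measurable function supported in the cube of half-side `η`. -/
structure IsCubeDensity (η : ℝ) (g : Space d → ℂ) : Prop where
  aestronglyMeasurable : AEStronglyMeasurable g
  bounded : ∃ B : ℝ, 0 ≤ B ∧ ∀ ω, ‖g ω‖ ≤ B
  support : ∀ ω, ω ∉ cube d η → g ω = 0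

lemma IsCubeDensity.integrable {η : ℝ} {g : Space d → ℂ} (hg : IsCubeDensity η g) :
    Integrable g := by
  obtain ⟨B, -, hB⟩ := hg.bounded
  have : IntegrableOn g (cube d η) :=
    IntegrableOn.of_bound (volume_cube_lt_top d η) hg.aestronglyMeasurable.restrict B
      (by filter_upwards with ω; exact hB ω)
  exact (integrableOn_iff_integrable_of_support_subset fun ω hω => by
    by_contra h; exact hω (hg.support ω h)).mp this

lemma norm_exp_I_inner (x ω : Space d) :
    ‖Complex.exp (Complex.I * (inner ℝ x ω : ℝ))‖ = 1 := by
  rw [mul_comm]; exact Complex.norm_exp_ofReal_mul_I _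

lemma integrable_exp_mul {g : Space d → ℂ} (hg : Integrable g) (x : Space d) :
    Integrable fun ω => Complex.exp (Complex.I * (inner ℝ x ω : ℝ)) * g ω :=
  hg.bdd_mul (c := 1) (by fun_prop) (by filter_upwards with ω; rw [norm_exp_I_inner])

/-- `f` is the inverse Fourier transform of a bounded function supported in the cube of half-side
`η`. -/
def IsBandLimited (η : ℝ) (f : Space d → ℂ) : Prop :=
  ∃ g, IsCubeDensity η g ∧ ∀ x, f x = invFourierT g x

namespace IsBandLimited

variable {η η₁ η₂ : ℝ} {f f₁ f₂ : Space d → ℂ}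

lemma zero (η : ℝ) : IsBandLimited η fun _ : Space d => (0 : ℂ) :=
  ⟨0, ⟨aestronglyMeasurable_const, ⟨0, le_rfl, by simp⟩, by simp⟩, by simp [invFourierT]⟩

lemma add (h₁ : IsBandLimited η f₁) (h₂ : IsBandLimited η f₂) :
    IsBandLimited η fun x => f₁ x + f₂ x := by
  obtain ⟨g₁, hg₁, e₁⟩ := h₁
  obtain ⟨g₂, hg₂, e₂⟩ := h₂
  obtain ⟨B₁, hB₁, b₁⟩ := hg₁.bounded
  obtain ⟨B₂, hB₂, b₂⟩ := hg₂.bounded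
  refine ⟨g₁ + g₂, ⟨hg₁.aestronglyMeasurable.add hg₂.aestronglyMeasurable,
    ⟨B₁ + B₂, by positivity, fun ω => (norm_add_le _ _).trans (add_le_add (b₁ ω) (b₂ ω))⟩,
    fun ω h => by simp [hg₁.support ω h, hg₂.support ω h]⟩, fun x => ?_⟩
  beta_reduce
  rw [e₁, e₂, invFourierT, invFourierT, invFourierT, ← integral_add
    (integrable_exp_mul hg₁.integrable x) (integrable_exp_mul hg₂.integrable x)]
  simp [mul_add]

lemma const_mul (c : ℂ) (h : IsBandLimited η f) : IsBandLimited η fun x => c * f x := by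
  obtain ⟨g, hg, e⟩ := h
  obtain ⟨B, hB, b⟩ := hg.bounded
  refine ⟨fun ω => c * g ω, ⟨hg.aestronglyMeasurable.const_mul c,
    ⟨‖c‖ * B, by positivity, fun ω => by rw [norm_mul]; gcongr; exact b ω⟩,
    fun ω h => by simp [hg.support ω h]⟩, fun x => ?_⟩
  simp only [e, invFourierT, mul_left_comm _ c, integral_const_mul]

lemma sum {ι : Type*} (s : Finset ι) {F : ι → Space d → ℂ} (h : ∀ i, IsBandLimited η (F i)) :
    IsBandLimited η fun x => ∑ i ∈ s, F i x := by
  classical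
  induction s using Finset.induction_on with
  | empty => simpa using zero η
  | insert i s hi ih => simpa only [Finset.sum_insert hi] using (h i).add ih

lemma comp_sub (h : IsBandLimited η f) (y : Space d) : IsBandLimited η fun x => f (x - y) := by
  obtain ⟨g, hg, e⟩ := h
  obtain ⟨B, hB, b⟩ := hg.bounded
  refine ⟨fun ω => Complex.exp (Complex.I * (inner ℝ (-y) ω : ℝ)) * g ω,
    ⟨AEStronglyMeasurable.mul (by fun_prop) hg.aestronglyMeasurable,
    ⟨B, hB, fun ω => by rw [norm_mul, norm_exp_I_inner, one_mul]; exact b ω⟩,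
    fun ω h => by simp [hg.support ω h]⟩, fun x => ?_⟩
  simp only [e, invFourierT, ← mul_assoc, ← Complex.exp_add, ← mul_add, sub_eq_add_neg,
    inner_add_left, Complex.ofReal_add]

lemma comp_neg (h : IsBandLimited η f) : IsBandLimited η fun x => f (-x) := by
  obtain ⟨g, hg, e⟩ := h
  obtain ⟨B, hB, b⟩ := hg.bounded
  refine ⟨fun ω => g (-ω), ⟨?_, ⟨B, hB, fun ω => b (-ω)⟩, fun ω h => hg.support _ fun h' => h ?_⟩,
    fun x => ?_⟩
  · exact hg.aestronglyMeasurable.comp_quasiMeasurePreserving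
      (Measure.measurePreserving_neg volume).quasiMeasurePreserving
  · intro j; simpa using h' j
  · beta_reduce
    rw [e, invFourierT, invFourierT, ← integral_neg_eq_self]
    simp

/-- The spectrum of a product is the convolution of the spectra, whose supporting cubes add. -/
lemma mul (h₁ : IsBandLimited η₁ f₁) (h₂ : IsBandLimited η₂ f₂) :
    IsBandLimited (η₁ + η₂) fun x => f₁ x * f₂ x := by
  obtain ⟨g₁, hg₁, e₁⟩ := h₁
  obtain ⟨g₂, hg₂, e₂⟩ := h₂
  obtain ⟨B₂, hB₂, b₂⟩ := hg₂.bounded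
  have i₁ := hg₁.integrable
  have i₂ := hg₂.integrable
  set L := ContinuousLinearMap.mul ℝ ℂ
  refine ⟨convolution g₁ g₂ L volume,
    ⟨(i₁.integrable_convolution L i₂).aestronglyMeasurable,
      ⟨(∫ s, ‖g₁ s‖) * B₂, by positivity, fun ω => ?_⟩, fun ω hω => ?_⟩, fun x => ?_⟩
  · rw [convolution_def, ← integral_mul_const]
    refine norm_integral_le_of_norm_le (i₁.norm.mul_const B₂) ?_
    filter_upwards with s
    simp only [L, ContinuousLinearMap.mul_apply', norm_mul]
    gcongr
    exact b₂ _
  · rw [convolution_def]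
    refine integral_eq_zero_of_ae ?_
    filter_upwards with s
    simp only [L, ContinuousLinearMap.mul_apply', Pi.zero_apply, mul_eq_zero]
    by_contra! h
    have m₁ : s ∈ cube d η₁ := by by_contra h'; exact h.1 (hg₁.support _ h')
    have m₂ : ω - s ∈ cube d η₂ := by by_contra h'; exact h.2 (hg₂.support _ h')
    refine hω fun j => ?_
    calc |ω j| = |s j + (ω - s) j| := by simp
      _ ≤ |s j| + |(ω - s) j| := abs_add_le _ _
      _ ≤ η₁ + η₂ := add_le_add (m₁ j) (m₂ j)
  · have h := integral_convolution L (μ := volume) (ν := volume) (integrable_exp_mul i₁ x)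
      (integrable_exp_mul i₂ x)
    beta_reduce
    rw [e₁, e₂]
    simp only [invFourierT]
    rw [show ∀ a b : ℂ, a * b = L a b from fun _ _ => rfl, ← h]
    congr 1
    ext ω
    simp only [convolution_def, L, ContinuousLinearMap.mul_apply', ← integral_const_mul]
    congr 1
    ext s
    rw [mul_mul_mul_comm, ← Complex.exp_add, ← mul_add, ← Complex.ofReal_add, ← inner_add_right,
      add_sub_cancel]

end IsBandLimited

lemma isBandLimited_sincProd {a : ℝ} (ha : 0 < a) :
    IsBandLimited a fun x : Space d => (sincProd a x : ℂ) := by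
  have hc : (2 * (a : ℂ)) ^ d ≠ 0 := pow_ne_zero _ (by simp [ha.ne'])
  have h1 : IsBandLimited a fun x : Space d => (2 * (a : ℂ)) ^ d * sincProd a x := by
    refine ⟨(cube d a).indicator 1, ⟨(measurable_one.indicator
      (measurableSet_cube d a)).aestronglyMeasurable, ⟨1, zero_le_one, fun ω => ?_⟩,
      fun ω hω => Set.indicator_of_notMem hω _⟩, fun x => ?_⟩
    · exact (norm_indicator_le_norm_self _ _).trans (by simp)
    · beta_reduce
      rw [← charFun_restrict_cube ha, charFun_apply, ← integral_indicator (measurableSet_cube d a),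
        invFourierT]
      congr 1
      ext ω
      by_cases hω : ω ∈ cube d a <;> simp [hω, real_inner_comm, mul_comm]
  have h2 := h1.const_mul ((2 * (a : ℂ)) ^ d)⁻¹
  simpa [← mul_assoc, hc] using h2

lemma isBandLimited_fejer {a : ℝ} (ha : 0 < a) :
    IsBandLimited (2 * a) fun x : Space d => (fejer a x : ℂ) := by
  have h := (isBandLimited_sincProd (d := d) ha).mul (isBandLimited_sincProd ha)
  rw [← two_mul] at h
  simpa [fejer, sq] using h

lemma isBandLimited_fejerSum {a : ℝ} (ha : 0 < a) {K : ℕ} (t : Fin K → Space d) (α : Fin K → ℝ) :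
    IsBandLimited (2 * a) fun x => (fejerSum a t α x : ℂ) := by
  simpa [fejerSum] using IsBandLimited.sum Finset.univ fun l =>
    ((isBandLimited_fejer ha).comp_sub (t l)).const_mul (α l : ℂ)

lemma isBandLimited_certificate {a : ℝ} (ha : 0 < a) {K : ℕ} (t : Fin K → Space d)
    (α : Fin K → ℝ) (k : Fin K) :
    IsBandLimited (8 * a) fun x => (certificate a t α k x : ℂ) := by
  have h1 := isBandLimited_fejerSum ha t α
  have h2 := (h1.comp_neg).comp_sub (t k + t k)
  have h3 : IsBandLimited (2 * a) fun x => (fejerSum a t α (t k - (x - t k)) : ℂ) := by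
    convert h2 using 4
    abel
  have h4 := h1.mul h3
  have h5 := h4.mul h4
  rw [show 2 * a + 2 * a + (2 * a + 2 * a) = 8 * a by ring] at h5
  simpa [certificate, sq] using h5

end SuperMix

/-! ### Deconvolution and membership in the reproducing kernel Hilbert space. -/

namespace SuperMix

/-- A function defining a bounded functional on the span of the kernel functions belongs to the
reproducing kernel Hilbert space. -/
lemma exists_rkhs_eq_of_bound {H X : Type*} [NormedAddCommGroup H] [InnerProductSpace ℝ H]
    [CompleteSpace H] [RKHS ℝ H X ℝ] (f : X → ℝ) (M : ℝ)
    (hf : ∀ a : X →₀ ℝ, |a.sum fun x r => r * f x| ≤ M * ‖a.sum fun x r => r • RKHS.kerFun H x 1‖) :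
    ∃ c : H, ∀ x, c x = f x := by
  set T : (X →₀ ℝ) →ₗ[ℝ] H := Finsupp.linearCombination ℝ fun x => RKHS.kerFun H x (1 : ℝ)
  set ℓ : (X →₀ ℝ) →ₗ[ℝ] ℝ := Finsupp.linearCombination ℝ f
  have hle : ∀ a, |ℓ a| ≤ M * ‖T a‖ := fun a => by
    simpa [T, ℓ, Finsupp.linearCombination_apply] using hf a
  -- The bound forces `ℓ` to vanish on `ker T`, so `ℓ` factors through `T`; Hahn–Banach and Riesz
  -- then represent it on all of `H`.
  obtain ⟨ℓ', hℓ'⟩ : ∃ ℓ' : H →ₗ[ℝ] ℝ, ∀ a, ℓ' (T a) = ℓ a := by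
    have hmem : ℓ ∈ LinearMap.range T.dualMap := by
      rw [LinearMap.range_dualMap_eq_dualAnnihilator_ker, Submodule.mem_dualAnnihilator]
      intro a ha
      have := hle a
      rw [LinearMap.mem_ker.mp ha, norm_zero, mul_zero] at this
      exact abs_eq_zero.mp (le_antisymm this (abs_nonneg _))
    obtain ⟨ℓ', h⟩ := hmem
    exact ⟨ℓ', fun a => by rw [← h, LinearMap.dualMap_apply]⟩
  set p := LinearMap.range T
  obtain ⟨L, hL, -⟩ := exists_extension_norm_eq p
    ((ℓ'.domRestrict p).mkContinuous M (by
      rintro ⟨_, a, rfl⟩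
      rw [LinearMap.domRestrict_apply, hℓ']
      exact hle a))
  refine ⟨(InnerProductSpace.toDual ℝ H).symm L, fun x => ?_⟩
  have h1 := RKHS.inner_kerFun (𝕜 := ℝ) x (1 : ℝ) ((InnerProductSpace.toDual ℝ H).symm L)
  rw [InnerProductSpace.toDual_symm_apply] at h1
  have h2 : T (Finsupp.single x 1) = RKHS.kerFun H x (1 : ℝ) := by simp [T]
  have h3 := hL ⟨T (Finsupp.single x 1), LinearMap.mem_range_self _ _⟩
  rw [LinearMap.mkContinuous_apply, LinearMap.domRestrict_apply, hℓ'] at h3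
  have h4 : L (RKHS.kerFun H x (1 : ℝ)) = ℓ (Finsupp.single x 1) := h2 ▸ h3
  rw [h4] at h1
  simpa [ℓ] using h1.symm

variable {d : ℕ}

/-- The trigonometric sum with frequencies in the support of `a`. -/
noncomputable def trigSum (a : Space d →₀ ℝ) (ω : Space d) : ℂ :=
  ∑ x ∈ a.support, (a x : ℂ) * Complex.exp (Complex.I * (inner ℝ x ω : ℝ))

lemma sq_norm_trigSum (a : Space d →₀ ℝ) (ω : Space d) :
    ((‖trigSum a ω‖ ^ 2 : ℝ) : ℂ) = ∑ x ∈ a.support, ∑ y ∈ a.support,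
      (a x : ℂ) * a y * Complex.exp (Complex.I * (inner ℝ (x - y) ω : ℝ)) := by
  push_cast
  rw [← Complex.mul_conj', trigSum, map_sum, Finset.sum_mul_sum]
  refine Finset.sum_congr rfl fun x _ => Finset.sum_congr rfl fun y _ => ?_
  rw [map_mul, ← Complex.exp_conj, map_mul, Complex.conj_I, Complex.conj_ofReal,
    Complex.conj_ofReal, mul_mul_mul_comm, ← Complex.exp_add, inner_sub_left]
  congr 2
  push_cast
  ring

lemma norm_trigSum_le (a : Space d →₀ ℝ) (ω : Space d) :
    ‖trigSum a ω‖ ≤ ∑ x ∈ a.support, |a x| :=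
  (norm_sum_le _ _).trans_eq (Finset.sum_congr rfl fun x _ => by
    rw [norm_mul, norm_exp_I_inner, mul_one, Complex.norm_real, Real.norm_eq_abs])

lemma continuous_trigSum (a : Space d →₀ ℝ) : Continuous (trigSum a) := by
  unfold trigSum; fun_prop

lemma integrable_sq_norm_trigSum_mul (a : Space d →₀ ℝ) {ρ : Space d → ℝ} (hρ : Integrable ρ) :
    Integrable fun ω => ‖trigSum a ω‖ ^ 2 * ρ ω := by
  have hc := continuous_trigSum a
  refine hρ.bdd_mul (c := (∑ x ∈ a.support, |a x|) ^ 2) (by fun_prop) ?_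
  filter_upwards with ω
  rw [norm_pow, norm_norm]
  gcongr
  exact norm_trigSum_le a ω

section RKHS
variable {H : Type*} [NormedAddCommGroup H] [InnerProductSpace ℝ H] [CompleteSpace H]
  [RKHS ℝ H (Space d) ℝ] {lam ρ : Space d → ℝ}

/-- Sending the kernel function at `x` to the character `e^{i⟨x, ω⟩}` is an isometry into `L²(ρ)`,
so RKHS norms can be computed on the spectral side. -/
lemma integral_sq_norm_trigSum (hρ : IsSpectralDensity lam ρ) (hH : HasKernel H lam)
    (a : Space d →₀ ℝ) :
    ∫ ω, ‖trigSum a ω‖ ^ 2 * ρ ω = ‖a.sum fun x r => r • RKHS.kerFun H x (1 : ℝ)‖ ^ 2 := by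
  have hi : ∀ x y : Space d, Integrable fun ω => (a x : ℂ) * a y *
      (Complex.exp (Complex.I * (inner ℝ (x - y) ω : ℝ)) * (ρ ω : ℂ)) := fun x y =>
    (integrable_exp_mul hρ.integrable.ofReal (x - y)).const_mul _
  have h1 : ((∫ ω, ‖trigSum a ω‖ ^ 2 * ρ ω : ℝ) : ℂ)
      = ∑ x ∈ a.support, ∑ y ∈ a.support, (a x : ℂ) * a y * lam (x - y) := by
    rw [← integral_complex_ofReal]
    have : ∀ ω, ((‖trigSum a ω‖ ^ 2 * ρ ω : ℝ) : ℂ) = ∑ x ∈ a.support, ∑ y ∈ a.support,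
        (a x : ℂ) * a y * (Complex.exp (Complex.I * (inner ℝ (x - y) ω : ℝ)) * (ρ ω : ℂ)) := by
      intro ω
      rw [Complex.ofReal_mul, sq_norm_trigSum]
      simp only [Finset.sum_mul, mul_assoc]
    simp only [this]
    rw [integral_finsetSum _ fun x _ => integrable_finsetSum _ fun y _ => hi x y]
    refine Finset.sum_congr rfl fun x _ => ?_
    rw [integral_finsetSum _ fun y _ => hi x y]
    refine Finset.sum_congr rfl fun y _ => ?_
    rw [integral_const_mul, hρ.eq_integral]
  have h2 : ‖a.sum fun x r => r • RKHS.kerFun H x (1 : ℝ)‖ ^ 2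
      = ∑ x ∈ a.support, ∑ y ∈ a.support, a x * a y * lam (x - y) := by
    rw [← real_inner_self_eq_norm_sq, Finsupp.sum, sum_inner]
    refine Finset.sum_congr rfl fun x _ => ?_
    rw [inner_sum]
    refine Finset.sum_congr rfl fun y _ => ?_
    rw [real_inner_smul_left, real_inner_smul_right, RKHS.kerFun_inner,
      RKHS.kerFun_apply, hH]
    simp [mul_assoc]
  rw [h2]
  exact_mod_cast h1

/-- Take `s = N`; when `N = 0`, let `s` be small. With the weighted AM-GM bound, this plays the role
of Cauchy–Schwarz. -/
lemma le_of_forall_pos_le_add_sq_div {X V N : ℝ} (hN : 0 ≤ N)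
    (h : ∀ s, 0 < s → X ≤ s * V + N ^ 2 / s) : X ≤ (V + 1) * N := by
  rcases hN.eq_or_lt with rfl | hN
  · have hX : ∀ s, 0 < s → X ≤ s * V := fun s hs => by simpa using h s hs
    rw [mul_zero]
    by_contra! h0
    have h1 := hX (X / (2 * (|V| + 1))) (by positivity)
    rw [div_mul_eq_mul_div, le_div_iff₀ (by positivity)] at h1
    nlinarith [le_abs_self V, abs_nonneg V]
  · have := h N hN
    rw [sq, mul_div_assoc, div_self hN.ne'] at this
    linarith

/-- An inverse Fourier transform `∫ e^{i ⟨x, ω⟩} G(ω) dω` with `|G| ≤ M √ρ` on a cube and `G = 0`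
elsewhere has its real part in the space whose kernel has spectral density `ρ`. -/
lemma exists_rkhs_eq_invFourierT (hρ : IsSpectralDensity lam ρ) (hH : HasKernel H lam) {η M : ℝ}
    (hM : 0 ≤ M) {G : Space d → ℂ} (hG : Integrable G)
    (hGM : ∀ᵐ ω, ‖G ω‖ ≤ (cube d η).indicator (fun ω => M * √(ρ ω)) ω) :
    ∃ c : H, ∀ x, c x = (invFourierT G x).re := by
  set V : ℝ := volume.real (cube d η)
  refine exists_rkhs_eq_of_bound _ (M * (V + 1)) fun a => ?_
  have e : (a.sum fun x r => r * (invFourierT G x).re) = (∫ ω, trigSum a ω * G ω).re := by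
    simp only [trigSum, Finset.sum_mul, mul_assoc]
    rw [integral_finsetSum _ fun x _ => (integrable_exp_mul hG x).const_mul _, Complex.re_sum,
      Finsupp.sum]
    refine Finset.sum_congr rfl fun x _ => ?_
    rw [integral_const_mul, Complex.re_ofReal_mul, invFourierT]
  rw [e, mul_assoc]
  set N := ‖a.sum fun x r => r • RKHS.kerFun H x (1 : ℝ)‖ with hN
  have hNi := integral_sq_norm_trigSum hρ hH a
  rw [← hN] at hNi
  have hi := integrable_sq_norm_trigSum_mul a hρ.integrable
  have hic : Integrable ((cube d η).indicator fun _ => (1 : ℝ)) :=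
    (integrable_indicator_iff (measurableSet_cube d η)).mpr
      (integrableOn_const (volume_cube_lt_top d η).ne)
  have hV : ∫ ω, (cube d η).indicator (fun _ => (1 : ℝ)) ω = V :=
    integral_indicator_one (measurableSet_cube d η)
  refine (Complex.abs_re_le_norm _).trans ?_
  have hbound : ∀ s, 0 < s → ‖∫ ω, trigSum a ω * G ω‖ ≤ M * (s * V + N ^ 2 / s) := by
    intro s hs
    have e2 : M * (s * V + N ^ 2 / s) = ∫ ω, M * (s * (cube d η).indicator (fun _ => (1 : ℝ)) ω
        + ‖trigSum a ω‖ ^ 2 * ρ ω / s) := by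
      rw [integral_const_mul, integral_add (hic.const_mul s) (hi.div_const s), integral_const_mul,
        integral_div, hV, hNi]
    rw [e2]
    refine norm_integral_le_of_norm_le (((hic.const_mul s).add (hi.div_const s)).const_mul M) ?_
    filter_upwards [hGM] with ω hω
    rw [norm_mul]
    have hρ0 := hρ.nonneg ω
    by_cases hc : ω ∈ cube d η
    · simp only [Set.indicator_of_mem hc] at hω ⊢
      have hsq := Real.sq_sqrt hρ0
      set r := √(ρ ω)
      have hr : 0 ≤ r := Real.sqrt_nonneg _
      set F := ‖trigSum a ω‖
      have hF : 0 ≤ F := norm_nonneg _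
      have key : F * r ≤ s * 1 + F ^ 2 * ρ ω / s := by
        rw [← hsq, mul_one, ← sub_le_iff_le_add', le_div_iff₀ hs]
        nlinarith [sq_nonneg (F * r - s), mul_nonneg hF hr]
      calc F * ‖G ω‖ ≤ F * (M * r) := by gcongr
        _ = M * (F * r) := by ring
        _ ≤ _ := by gcongr
    · simp only [Set.indicator_of_notMem hc] at hω ⊢
      rw [le_antisymm hω (norm_nonneg _), mul_zero]
      positivity
  rcases hM.eq_or_lt with rfl | hM
  · simpa using hbound 1 one_pos
  · rw [← div_le_iff₀' hM]
    exact le_of_forall_pos_le_add_sq_div (norm_nonneg _) fun s hs => by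
      rw [div_le_iff₀' hM]; exact hbound s hs

end RKHS

lemma continuous_invFourierT {g : Space d → ℂ} (hg : Integrable g) :
    Continuous (invFourierT g) := by
  refine continuous_of_dominated (bound := fun ω => ‖g ω‖)
    (fun x => (integrable_exp_mul hg x).aestronglyMeasurable)
    (fun x => ?_) hg.norm (by filter_upwards with ω; fun_prop)
  filter_upwards with ω
  rw [norm_mul, norm_exp_I_inner, one_mul]

lemma norm_invFourierT_le (g : Space d → ℂ) (x : Space d) : ‖invFourierT g x‖ ≤ ∫ ω, ‖g ω‖ := by
  refine (norm_integral_le_integral_norm _).trans_eq ?_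
  simp only [norm_mul, norm_exp_I_inner, one_mul]

lemma fourierT_eq_invFourierT (φ : Space d → ℝ) (ω : Space d) :
    fourierT φ ω = invFourierT (fun x => (φ x : ℂ)) (-ω) := by
  simp [fourierT, invFourierT]

lemma continuous_fourierT {φ : Space d → ℝ} (hφ : Integrable φ) : Continuous (fourierT φ) := by
  rw [funext (fourierT_eq_invFourierT φ)]
  exact (continuous_invFourierT hφ.ofReal).comp continuous_neg

/-- Convolving with `φ` multiplies the spectrum by the Fourier transform of `φ`. -/
lemma integral_mul_invFourierT_sub {φ : Space d → ℝ} (hφ : Integrable φ) {G : Space d → ℂ}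
    (hG : Integrable G) (x : Space d) :
    ∫ s, (φ s : ℂ) * invFourierT G (x - s) = invFourierT (fun ω => fourierT φ ω * G ω) x := by
  simp only [invFourierT, fourierT, ← integral_const_mul, ← integral_mul_const]
  rw [integral_integral_swap]
  · congr 1
    ext ω
    congr 1
    ext s
    rw [inner_sub_left, real_inner_comm s ω, Complex.ofReal_sub, mul_sub, sub_eq_add_neg,
      Complex.exp_add]
    ring
  · have h := (hφ.ofReal (𝕜 := ℂ)).mul_prod hG
    have h2 := h.bdd_mul (c := 1)
      (f := fun z : Space d × Space d => Complex.exp (Complex.I * (inner ℝ (x - z.1) z.2 : ℝ)))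
      (by fun_prop) (by filter_upwards with z; rw [norm_exp_I_inner])
    refine h2.congr ?_
    filter_upwards with z
    simp only [Function.uncurry]
    exact mul_left_comm _ _ _

/-- A real band-limited function is the convolution of `φ` with an element of the reproducing
kernel Hilbert space, if the spectra are bounded below on the band. -/
theorem exists_rkhs_convolution_eq {H : Type*} [NormedAddCommGroup H] [InnerProductSpace ℝ H]
    [CompleteSpace H] [RKHS ℝ H (Space d) ℝ] {φ lam ρ Q : Space d → ℝ} {η : ℝ}
    (hφ : Integrable φ) (hρ : IsSpectralDensity lam ρ) (hH : HasKernel H lam)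
    (hσ : SpectrumContainsCube φ η) (hinf : SpectralInfPos φ ρ η)
    (hQ : IsBandLimited η fun x => (Q x : ℂ)) :
    ∃ c : H, ConvolutionExists φ (⇑c) (ContinuousLinearMap.mul ℝ ℝ) volume ∧ Q = Phi φ ⇑c := by
  obtain ⟨g, hg, hgQ⟩ := hQ
  obtain ⟨B, hB, hgB⟩ := hg.bounded
  obtain ⟨b, hb, hbρ⟩ := hinf
  -- Outside the cube `fourierT φ` may vanish, but `g` is zero there and so is `G`.
  set G : Space d → ℂ := fun ω => (fourierT φ ω)⁻¹ * g ω with hGdef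
  have hσG : (fun ω => fourierT φ ω * G ω) = g := by
    ext ω
    by_cases hω : ω ∈ cube d η
    · exact mul_inv_cancel_left₀ (hσ ω hω) _
    · simp [hGdef, hg.support ω hω]
  have hGM : ∀ᵐ ω, ‖G ω‖ ≤ (cube d η).indicator (fun ω => B / √b * √(ρ ω)) ω := by
    filter_upwards [hbρ] with ω hω
    by_cases hc : ω ∈ cube d η
    · rw [Set.indicator_of_mem hc, hGdef, norm_mul, norm_inv, div_mul_eq_mul_div,
        inv_mul_eq_div, div_le_div_iff₀ (norm_pos_iff.mpr (hσ ω hc)) (Real.sqrt_pos.mpr hb)]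
      have h := Real.sqrt_le_sqrt (hω hc)
      rw [Real.sqrt_mul (sq_nonneg _), Real.sqrt_sq (norm_nonneg _)] at h
      calc ‖g ω‖ * √b ≤ B * (‖fourierT φ ω‖ * √(ρ ω)) := by gcongr; exact hgB ω
        _ = _ := by ring
    · rw [Set.indicator_of_notMem hc]
      simp [hGdef, hg.support ω hc]
  have hic : Integrable ((cube d η).indicator fun _ => (1 : ℝ)) :=
    (integrable_indicator_iff (measurableSet_cube d η)).mpr
      (integrableOn_const (volume_cube_lt_top d η).ne)
  -- `G` is dominated through `√ρ ≤ 1 + ρ` on the cube, which has finite volume.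
  have hGi : Integrable G := by
    refine Integrable.mono' ((hic.add hρ.integrable).const_mul (B / √b))
      ((continuous_fourierT hφ).measurable.inv.aestronglyMeasurable.mul
        hg.aestronglyMeasurable) ?_
    filter_upwards [hGM] with ω hω
    refine hω.trans ?_
    have hρ0 := hρ.nonneg ω
    by_cases hc : ω ∈ cube d η
    · simp only [Pi.add_apply, Set.indicator_of_mem hc]
      gcongr
      rw [Real.sqrt_le_left (by linarith)]
      nlinarith
    · simp only [Pi.add_apply, Set.indicator_of_notMem hc]
      positivity
  obtain ⟨c, hc⟩ := exists_rkhs_eq_invFourierT hρ hH (η := η) (by positivity) hGi hGM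
  have hcont := continuous_invFourierT hGi
  have hint : ∀ x, Integrable fun s => (φ s : ℂ) * invFourierT G (x - s) := fun x =>
    hφ.ofReal.mul_bdd (c := ∫ ω, ‖G ω‖) (by fun_prop)
      (by filter_upwards with s; exact norm_invFourierT_le _ _)
  have hre : ∀ x s, φ s * c (x - s) = ((φ s : ℂ) * invFourierT G (x - s)).re := fun x s => by
    rw [hc, Complex.re_ofReal_mul]
  refine ⟨c, fun x => ?_, funext fun x => ?_⟩
  · simp only [ConvolutionExistsAt, ContinuousLinearMap.mul_apply', hre]
    exact (hint x).re
  · simp only [Phi, convolution_def, ContinuousLinearMap.mul_apply', hre]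
    have h := integral_re (𝕜 := ℂ) (hint x)
    simp only [RCLike.re_eq_complex_re] at h
    rw [h, integral_mul_invFourierT_sub hφ hGi, hσG, ← hgQ, Complex.ofReal_re]

end SuperMix

theorem corollary8 :
    -- universal constants: `C₀` in the separation condition, `υ`, `γ`, and `C` (near regions)
    ∃ C₀ υ γ C : ℝ, 0 < C₀ ∧ 0 < υ ∧ 0 < γ ∧ 0 < C ∧
    ∀ (d K m : ℕ) (t : Fin K → SuperMix.Space d),
      1 ≤ d → 1 ≤ m → Function.Injective t →
      C₀ * √(K : ℝ) * (d : ℝ) ^ (3 / 2 : ℝ) / SuperMix.sepPlus t ≤ (m : ℝ) →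
      ∀ k : Fin K, ∃ Q : SuperMix.Space d → ℝ,
        -- interpolation and range
        (∀ i : Fin K, Q (t i) = if i = k then 1 else 0) ∧
        (∀ x, 0 ≤ Q x ∧ Q x ≤ 1) ∧
        -- near region of `t k`
        (∀ x ∈ SuperMix.nearRegion t k (υ / (m * d)),
          0 ≤ Q x ∧ Q x ≤ 1 - C * (m : ℝ) ^ 2 * ‖x - t k‖ ^ 2) ∧
        -- near regions of the other points
        (∀ i : Fin K, i ≠ k → ∀ x ∈ SuperMix.nearRegion t i (υ / (m * d)),
          |Q x| ≤ C * (m : ℝ) ^ 2 * ‖x - t i‖ ^ 2) ∧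
        -- far region
        (∀ x ∈ SuperMix.farRegion t (υ / (m * d)),
          0 ≤ Q x ∧ Q x ≤ 1 - γ * (υ ^ 2 / (d : ℝ) ^ 3)) ∧
        -- `Q = Φ c` with `c` in the RKHS of the kernel `lam (x - y)`
        (∀ φ lam ρ : SuperMix.Space d → ℝ,
          SuperMix.IsProbDensity φ → SuperMix.IsPosDefKernelFun φ →
          SuperMix.SpectrumContainsCube φ (4 * m) →
          SuperMix.IsPosDefKernelFun lam → SuperMix.IsSpectralDensity lam ρ →
          SuperMix.SpectralInfPos φ ρ (4 * m) →
          ∀ (H : Type*) [NormedAddCommGroup H] [InnerProductSpace ℝ H] [CompleteSpace H]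
            [RKHS ℝ H (SuperMix.Space d) ℝ], SuperMix.HasKernel H lam →
            ∃ c : H,
              MeasureTheory.ConvolutionExists φ (⇑c) (ContinuousLinearMap.mul ℝ ℝ)
                MeasureTheory.volume ∧
              Q = SuperMix.Phi φ ⇑c) := by

  refine ⟨1000, 1 / 10, 1 / 20, 1 / 5, by norm_num, by norm_num, by norm_num, by norm_num, ?_⟩
  intro d K m t hd hm ht hsep k
  obtain ⟨α, h1, h2⟩ := SuperMix.exists_fejerSum_interpolation hd hm ht hsep k
  have hnn := SuperMix.certificate_nonneg ((m : ℝ) / 2) t α k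
  have ha : (0 : ℝ) < (m : ℝ) / 2 := by positivity
  refine ⟨SuperMix.certificate (m / 2) t α k, SuperMix.certificate_apply h1,
    fun x => ⟨hnn x, ?_⟩,
    fun x hx => ⟨hnn x, SuperMix.certificate_le_near_self hd hm h1 h2 hx⟩,
    fun i hi x _ => ?_, fun x hx => ⟨hnn x, SuperMix.certificate_le_far hd hm h2 ?_⟩, ?_⟩
  -- The far estimate uses only the distance to `t k`, so it and the near estimate at `t k` together
  -- cover the whole space.
  · rcases le_total ‖x - t k‖ ((1 / 10 : ℝ) / (m * d)) with hx | hx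
    · refine (SuperMix.certificate_le_near_self hd hm h1 h2 hx).trans ?_
      linarith [show 0 ≤ 1 / 5 * (m : ℝ) ^ 2 * ‖x - t k‖ ^ 2 by positivity]
    · refine (SuperMix.certificate_le_far hd hm h2 hx).trans ?_
      linarith [show 0 ≤ 1 / 20 * ((1 / 10 : ℝ) ^ 2 / (d : ℝ) ^ 3) by positivity]
  · rw [abs_of_nonneg (hnn x)]
    exact SuperMix.certificate_le_near_other hd hm h1 h2 hi x
  · have hx' : x ∉ SuperMix.nearRegion t k (1 / 10 / (m * d)) := fun h =>
      hx (Set.mem_iUnion.mpr ⟨k, h⟩)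
    exact (not_le.mp hx').le
  · intro φ lam ρ hφ _ hσ _ hρ hinf H _ _ _ _ hH
    have hQ := SuperMix.isBandLimited_certificate ha t α k
    rw [show 8 * ((m : ℝ) / 2) = 4 * m by ring] at hQ
    exact SuperMix.exists_rkhs_convolution_eq hφ.integrable hρ hH hσ hinf hQ
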